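/- Let $\mathcal{H}$ be a complex Hilbert space and let $\mathcal{A}\subseteq B(\mathcal{H})$ be a factor von Neumann algebra, i.e. a von Neumann algebra whose centre $\mathcal{Z}(\mathcal{A})$ is $\mathbb{C}I$, with $\dim\mathcal{A}\ge 2$ (possibly infinite). Write $[x,y]=xy-yx$, $p_1(x_1)=x_1$ and $p_k(x_1,\dots,x_k)=[p_{k-1}(x_1,\dots,x_{k-1}),x_k]$ for $k\ge 2$. Let $n\ge 2$ be an integer. Then every Lie $n$-derivation on $\mathcal{A}$ is standard. That is, if $\delta:\mathcal{A}\to\mathcal{A}$ is a $\mathbb{C}$-linear map (not assumed continuous) with $$\delta(p_n(x_1,\dots,x_n))=\sum_{i=1}^{n}p_n(x_1,\dots,x_{i-1},\delta(x_i),x_{i+1},\dots,x_n)\qquad\text{for all }x_1,\dots,x_n\in\mathcal{A},$$ then $\delta=h+\tau$, where $h:\mathcal{A}\to\mathcal{A}$ is a derivation (a linear map with $h(xy)=h(x)y+xh(y)$ for all $x,y\in\mathcal{A}$) and $\tau:\mathcal{A}\to\mathcal{Z}(\mathcal{A})$ is a linear map with $\tau(p_n(x_1,\dots,x_n))=0$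 for all $x_1,\dots,x_n\in\mathcal{A}$. -/

import Mathlib

namespace LieN

/-- The polynomials `p_1(x_1) = x_1`, `p_n(x_1, …, x_n) = [p_{n-1}(x_1, …, x_{n-1}), x_n]`, where
`⁅a, b⁆ = a * b - b * a`. For `n ≥ 2` this is the `(n-1)`-th commutator of `x_1, …, x_n`.
The value at `n = 0` is a dummy. -/
def p {A : Type*} [Ring A] : (n : ℕ) → (Fin n → A) → A
  | 0, _ => 0
  | 1, x => x 0
  | n + 2, x => ⁅p (n + 1) (Fin.init x), x (Fin.last (n + 1))⁆

/-- Derivations of a (not necessarily commutative) algebra. -/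
def IsDerivation {R A : Type*} [CommRing R] [Ring A] [Algebra R A] (d : A →ₗ[R] A) : Prop :=
  ∀ x y : A, d (x * y) = d x * y + x * d y

/-- Lie `n`-derivations (meaningful for `n ≥ 2`). -/
def IsLieNDerivation {R A : Type*} [CommRing R] [Ring A] [Algebra R A]
    (n : ℕ) (δ : A →ₗ[R] A) : Prop :=
  ∀ x : Fin n → A, δ (p n x) = ∑ i : Fin n, p n (Function.update x i (δ (x i)))

/-- `δ` is the sum of a derivation and of a linear map into the centre that vanishes on all
`(n-1)`-th commutators. -/
def IsStandard {R A : Type*} [CommRing R] [Ring A] [Algebra R A]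
    (n : ℕ) (δ : A →ₗ[R] A) : Prop :=
  ∃ h τ : A →ₗ[R] A, IsDerivation h ∧ (∀ x : A, τ x ∈ Subalgebra.center R A) ∧
    (∀ x : Fin n → A, τ (p n x) = 0) ∧ δ = h + τ

/-- A von Neumann algebra is a factor if its centre consists of the scalar multiples of the
identity. -/
def IsFactor {H : Type*} [NormedAddCommGroup H] [InnerProductSpace ℂ H] [CompleteSpace H]
    (A : VonNeumannAlgebra H) : Prop :=
  (A : Set (H →L[ℂ] H)) ∩ (A.commutant : Set (H →L[ℂ] H)) =
    Set.range fun c : ℂ => c • (1 : H →L[ℂ] H)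

end LieN

namespace LieN

/-! The argument is algebraic. A factor of dimension at least 2 contains a nontrivial projection
`e`; with `f = 1 - e` it is a prime ring whose corners `eAe` and `fAf` have scalar centres
(`IsFactor.prime`, `IsFactor.corner`, `exists_projection`). Over a field of characteristic zero
these facts suffice (`IsPeircePair.isStandard`).

Write `n = m + 2`. Bracketing with `e` on the right acts as `-1` on `eAf`, as `1` on `fAe` and as
`0` on the diagonal corners. Subtracting an inner derivation makes `δ e` diagonal, and the identity
on `x, e, …, e` with `x` in `eAf` then makes it scalar. Copies of `e` can now pad a short commutator
to full length at no cost, so `δ` obeys the Leibniz rule for `[x, y]`, and for `[[x, y], z]` if `n ≥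
3`, in its `eAf` component. The sign mismatch in the `fAe` component forces `δ` to preserve `eAf`
and `fAe` (`cross_eq_zero`).

On `eAe` the map `δ` is diagonal with a scalar multiple of `f` in the opposite corner, and
symmetrically on `fAf`. Subtracting these scalars times `1` gives a map `h` preserving every Peirce
component. It is only known to satisfy the Lie identity up to scalars, whence the weak notion. The
Leibniz rule for `h` is checked component by component: primeness makes `eAf` a faithful bimodule,
and the one possible scalar defect, on `eAf · fAe`, is killed by `(xy)x = x(yx)`. -/

/-- The iterated commutator `⁅…⁅⁅u, t₁⁆, t₂⁆…, tₖ⁆`. -/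
def nest {A : Type*} [Ring A] (u : A) (t : List A) : A := t.foldl (fun a b => ⁅a, b⁆) u

/-- The sum of all iterated commutators obtained from `nest u t` by applying `δ` to one entry
of `t`. -/
def nestVar {A : Type*} [Ring A] (δ : A → A) : List A → A → A
  | [], _ => 0
  | c :: t, u => nest ⁅u, δ c⁆ t + nestVar δ t ⁅u, c⁆

/-! ### Iterated commutators over lists -/

section nest

variable {A : Type*} [Ring A]

@[simp] theorem bracket_zero_left (u : A) : ⁅(0 : A), u⁆ = 0 := by simp [Ring.lie_def]

theorem bracket_add_left (u v w : A) : ⁅u + v, w⁆ = ⁅u, w⁆ + ⁅v, w⁆ := by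
  simp only [Ring.lie_def, add_mul, mul_add]; abel

theorem bracket_add_right (u v w : A) : ⁅u, v + w⁆ = ⁅u, v⁆ + ⁅u, w⁆ := by
  simp only [Ring.lie_def, add_mul, mul_add]; abel

@[simp] theorem nest_nil (u : A) : nest u [] = u := rfl

@[simp] theorem nest_cons (u c : A) (t : List A) : nest u (c :: t) = nest ⁅u, c⁆ t := rfl

theorem nest_append_singleton (u c : A) (t : List A) : nest u (t ++ [c]) = ⁅nest u t, c⁆ := by
  simp [nest]

@[simp] theorem nest_zero (t : List A) : nest (0 : A) t = 0 := by
  induction t with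
  | nil => rfl
  | cons c t ih => simp [ih]

theorem nest_add (u v : A) (t : List A) : nest (u + v) t = nest u t + nest v t := by
  induction t generalizing u v with
  | nil => rfl
  | cons c t ih => simp [ih, bracket_add_left]

@[simp] theorem nestVar_nil (δ : A → A) (u : A) : nestVar δ [] u = 0 := rfl

@[simp] theorem nestVar_cons (δ : A → A) (u c : A) (t : List A) :
    nestVar δ (c :: t) u = nest ⁅u, δ c⁆ t + nestVar δ t ⁅u, c⁆ := rfl

@[simp] theorem nestVar_zero (δ : A → A) (t : List A) : nestVar δ t 0 = 0 := by
  induction t with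
  | nil => rfl
  | cons c t ih => simp [ih]

theorem nestVar_add (δ ε : A → A) (t : List A) (u : A) :
    nestVar (fun x => δ x + ε x) t u = nestVar δ t u + nestVar ε t u := by
  induction t generalizing u with
  | nil => simp
  | cons c t ih => simp only [nestVar_cons, ih, bracket_add_right, nest_add]; abel

theorem nestVar_congr {δ ε : A → A} {t : List A} (h : ∀ c ∈ t, ∀ w : A, ⁅w, δ c⁆ = ⁅w, ε c⁆)
    (u : A) : nestVar δ t u = nestVar ε t u := by
  induction t generalizing u with
  | nil => rfl
  | cons c t ih =>
    simp only [nestVar_cons]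
    rw [h c (by simp), ih fun c' hc' => h c' (by simp [hc'])]

theorem nestVar_eq_zero {δ : A → A} {t : List A} (h : ∀ c ∈ t, ∀ w : A, ⁅w, δ c⁆ = 0)
    (u : A) : nestVar δ t u = 0 := by
  induction t generalizing u with
  | nil => rfl
  | cons c t ih =>
    simp only [nestVar_cons]
    rw [h c (by simp), ih fun c' hc' => h c' (by simp [hc'])]
    simp

theorem p_succ (m : ℕ) (x : Fin (m + 1) → A) :
    p (m + 1) x = nest (x 0) (List.ofFn fun i : Fin m => x i.succ) := by
  induction m with
  | zero => simp [p]
  | succ m ih =>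
    rw [p, ih, List.ofFn_succ', List.concat_eq_append, nest_append_singleton]
    rfl

theorem sum_nest_update (δ : A → A) (m : ℕ) (t : Fin m → A) (u : A) :
    ∑ j, nest u (List.ofFn (Function.update t j (δ (t j)))) = nestVar δ (List.ofFn t) u := by
  induction m generalizing u with
  | zero => simp
  | succ m ih =>
    rw [Fin.sum_univ_succ, List.ofFn_succ (f := t), nestVar_cons, ← ih]
    congr 1
    · simp [List.ofFn_succ]
    · refine Finset.sum_congr rfl fun j _ => ?_
      rw [List.ofFn_succ, nest_cons, Function.update_of_ne (Fin.succ_ne_zero j).symm]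
      congr 2
      ext i
      by_cases hij : i = j
      · subst hij; simp
      · rw [Function.update_of_ne hij, Function.update_of_ne (by simpa using hij)]

theorem sum_p_update (δ : A → A) (m : ℕ) (x : Fin (m + 1) → A) :
    ∑ i, p (m + 1) (Function.update x i (δ (x i))) =
      nest (δ (x 0)) (List.ofFn fun i : Fin m => x i.succ) +
        nestVar δ (List.ofFn fun i : Fin m => x i.succ) (x 0) := by
  rw [Fin.sum_univ_succ, ← sum_nest_update]
  congr 1
  · simp [p_succ]
  · refine Finset.sum_congr rfl fun j _ => ?_
    rw [p_succ, Function.update_of_ne (Fin.succ_ne_zero j).symm]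
    congr 2
    ext i
    by_cases hij : i = j
    · subst hij; simp
    · rw [Function.update_of_ne hij, Function.update_of_ne (by simpa using hij)]

end nest

section algebra

variable {K A : Type*} [Field K] [Ring A] [Algebra K A]

theorem isLieNDerivation_iff (m : ℕ) (δ : A →ₗ[K] A) :
    IsLieNDerivation (m + 1) δ ↔ ∀ (u : A) (t : List A), t.length = m →
      δ (nest u t) = nest (δ u) t + nestVar δ t u := by
  constructor
  · rintro h u t rfl
    have := h (Fin.cons u t.get)
    rw [sum_p_update, p_succ] at this
    simpa using this
  · intro h x
    rw [sum_p_update, p_succ]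
    exact h _ _ (by simp)

theorem IsDerivation.map_lie {d : A →ₗ[K] A} (hd : IsDerivation d) (x y : A) :
    d ⁅x, y⁆ = ⁅d x, y⁆ + ⁅x, d y⁆ := by
  simp only [Ring.lie_def, map_sub, hd x y, hd y x]; abel

theorem IsDerivation.map_nest {d : A →ₗ[K] A} (hd : IsDerivation d) (u : A) (t : List A) :
    d (nest u t) = nest (d u) t + nestVar d t u := by
  induction t generalizing u with
  | nil => simp
  | cons c t ih => rw [nest_cons, ih, hd.map_lie, nest_add, nest_cons, nestVar_cons, add_assoc]

/-- A weakening of the notion of a Lie derivation in `m + 2` variables, in which the defining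
identity holds up to scalars. -/
def IsWeakLieDerivation (m : ℕ) (δ : A →ₗ[K] A) : Prop :=
  ∀ (u : A) (t : List A), t.length = m + 1 →
    ∃ c : K, δ (nest u t) = nest (δ u) t + nestVar δ t u + c • (1 : A)

/-! ### Peirce decomposition in a prime algebra -/

/-- `x` lies in the Peirce component `eAf`. -/
def Peirce (e f x : A) : Prop := e * x = x ∧ x * f = x

theorem Peirce.facts {e f g k x : A} (hx : Peirce e f x) (hg : g * e = 0) (hk : f * k = 0) :
    e * x = x ∧ x * f = x ∧ g * x = 0 ∧ x * k = 0 ∧ (∀ w, e * (x * w) = x * w) ∧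
      (∀ w, x * (f * w) = x * w) ∧ (∀ w, g * (x * w) = 0) ∧ ∀ w, x * (k * w) = 0 := by
  have h1 : g * x = 0 := by rw [← hx.1, ← mul_assoc, hg, zero_mul]
  have h2 : x * k = 0 := by rw [← hx.2, mul_assoc, hk, mul_zero]
  exact ⟨hx.1, hx.2, h1, h2, fun w => by rw [← mul_assoc, hx.1], fun w => by rw [← mul_assoc, hx.2],
    fun w => by rw [← mul_assoc, h1, zero_mul], fun w => by rw [← mul_assoc, h2, zero_mul]⟩

variable (K) in
/-- Complementary nonzero idempotents `e` and `f` in a prime algebra over `K`, such that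
the centres of the corners `eAe` and `fAf` are trivial. -/
structure IsPeircePair (e f : A) : Prop where
  add_eq_one : e + f = 1
  mul_left : e * f = 0
  mul_right : f * e = 0
  left_ne : e ≠ 0
  right_ne : f ≠ 0
  prime : ∀ x y : A, (∀ a, x * a * y = 0) → x = 0 ∨ y = 0
  corner_left : ∀ z, Peirce e e z → (∀ a, Peirce e e a → z * a = a * z) → ∃ c : K, z = c • e
  corner_right : ∀ z, Peirce f f z → (∀ a, Peirce f f a → z * a = a * z) → ∃ c : K, z = c • f

namespace IsPeircePair

variable {e f : A} (S : IsPeircePair K e f)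
include S

theorem symm : IsPeircePair K f e :=
  ⟨by rw [add_comm, S.add_eq_one], S.mul_right, S.mul_left, S.right_ne, S.left_ne, S.prime,
    S.corner_right, S.corner_left⟩

theorem peirce_left : Peirce e e e := by
  have h : e * e = e := by
    have := congrArg (e * ·) S.add_eq_one
    simpa [mul_add, S.mul_left] using this
  exact ⟨h, h⟩

theorem peirce_right : Peirce f f f := S.symm.peirce_left

theorem peirce_left_left (x : A) : Peirce e e (e * x * e) := by
  obtain ⟨h, -, -, -, h', -⟩ := S.peirce_left.facts S.mul_right S.mul_left
  simp [Peirce, mul_assoc, h, h']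

theorem peirce_left_right (x : A) : Peirce e f (e * x * f) := by
  obtain ⟨h, -, -, -, h', -⟩ := S.peirce_left.facts S.mul_right S.mul_left
  obtain ⟨k, -, -, -, k', -⟩ := S.peirce_right.facts S.mul_left S.mul_right
  simp [Peirce, mul_assoc, h', k]

theorem decomposition (x : A) : x = e * x * e + e * x * f + f * x * e + f * x * f := by
  calc x = (e + f) * x * (e + f) := by rw [S.add_eq_one, one_mul, mul_one]
    _ = _ := by simp only [add_mul, mul_add]; abel

theorem induction {P : A → Prop} (add : ∀ x y, P x → P y → P (x + y))
    (hee : ∀ x, Peirce e e x → P x) (hef : ∀ x, Peirce e f x → P x)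
    (hfe : ∀ x, Peirce f e x → P x) (hff : ∀ x, Peirce f f x → P x) (x : A) : P x := by
  rw [S.decomposition x]
  exact add _ _ (add _ _ (add _ _ (hee _ (S.peirce_left_left x)) (hef _ (S.peirce_left_right x)))
    (hfe _ (S.symm.peirce_left_right x))) (hff _ (S.symm.peirce_left_left x))

theorem eq_zero_of_mul_left {u : A} (hu : u * e = u) (h : ∀ x, Peirce e f x → u * x = 0) :
    u = 0 := by
  refine (S.prime u f fun a => ?_).resolve_right S.right_ne
  have := h _ (S.peirce_left_right a)
  rwa [← mul_assoc, ← mul_assoc, hu] at this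

theorem eq_zero_of_mul_right {u : A} (hu : f * u = u) (h : ∀ x, Peirce e f x → x * u = 0) :
    u = 0 := by
  refine (S.prime e u fun a => ?_).resolve_left S.left_ne
  have := h _ (S.peirce_left_right a)
  rwa [mul_assoc, hu] at this

/-- For `a` in `eAe`, `u(ax) = axv = a(ux)`, and `eAf` is faithful as a left `eAe`-module by
primeness. Hence `u` is central in its corner, and faithfulness on the right transfers the scalar to
`v`. -/
theorem exists_smul_of_intertwine {u v : A} (hu : Peirce e e u) (hv : Peirce f f v)
    (h : ∀ x, Peirce e f x → u * x = x * v) : ∃ c : K, u = c • e ∧ v = c • f := by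
  obtain ⟨c, hc⟩ := S.corner_left u hu fun a ha => by
    rw [← sub_eq_zero]
    refine S.eq_zero_of_mul_left (by rw [sub_mul, mul_assoc, mul_assoc, ha.2, hu.2]) fun x hx => ?_
    have hax : Peirce e f (a * x) :=
      ⟨by rw [← mul_assoc, ha.1], by rw [mul_assoc, hx.2]⟩
    rw [sub_mul, mul_assoc, mul_assoc, h _ hax, h _ hx, mul_assoc, sub_self]
  refine ⟨c, hc, ?_⟩
  rw [← sub_eq_zero]
  refine S.eq_zero_of_mul_right (by rw [mul_sub, hv.1, mul_smul_comm, S.peirce_right.1]) ?_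
  intro x hx
  rw [mul_sub, ← h x hx, hc, smul_mul_assoc, hx.1, mul_smul_comm, hx.2, sub_self]

theorem exists_smul_one_of_intertwine {u v : A} (hu : Peirce e e u) (hv : Peirce f f v)
    (h : ∀ x, Peirce e f x → u * x = x * v) : ∃ c : K, u + v = c • (1 : A) := by
  obtain ⟨c, rfl, rfl⟩ := S.exists_smul_of_intertwine hu hv h
  exact ⟨c, by rw [← smul_add, S.add_eq_one]⟩

theorem exists_smul_one_of_central {z : A} (h : ∀ x, z * x = x * z) : ∃ c : K, z = c • (1 : A) := by
  obtain ⟨hee, -, hfe, -⟩ := S.peirce_left.facts S.mul_right S.mul_left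
  obtain ⟨hff, -, hef, -⟩ := S.peirce_right.facts S.mul_left S.mul_right
  obtain ⟨c, hc⟩ := S.exists_smul_one_of_intertwine (S.peirce_left_left z)
    (S.symm.peirce_left_left z) fun x hx => by
      rw [mul_assoc, mul_assoc, hx.1, h x, ← mul_assoc, hx.1, mul_assoc, h f, ← mul_assoc,
        ← mul_assoc, hx.2, mul_assoc, ← mul_assoc, hx.2]
  refine ⟨c, hc ▸ ?_⟩
  conv_lhs => rw [S.decomposition z]
  have h1 : e * z * f = 0 := by rw [mul_assoc, h f, ← mul_assoc, hef, zero_mul]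
  have h2 : f * z * e = 0 := by rw [mul_assoc, h e, ← mul_assoc, hfe, zero_mul]
  rw [h1, h2, add_zero, add_zero]

/-- Since `[u, uy] = u[u, y]`, a nonzero scalar value of `[u, y]` would make `u` itself scalar, so
every bracket vanishes. -/
theorem central_of_bracket {u : A} (h : ∀ y, ∃ c : K, ⁅u, y⁆ = c • (1 : A)) :
    ∃ c : K, u = c • (1 : A) := by
  refine S.exists_smul_one_of_central fun y => ?_
  obtain ⟨c, hc⟩ := h y
  obtain ⟨d, hd⟩ := h (u * y)
  have h1 : ⁅u, u * y⁆ = u * ⁅u, y⁆ := by simp only [Ring.lie_def, mul_sub, mul_assoc]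
  rw [hc, mul_smul_comm, mul_one] at h1
  rw [← sub_eq_zero, ← Ring.lie_def]
  by_cases hc0 : c = 0
  · rw [hc, hc0, zero_smul]
  · have : u = (c⁻¹ * d) • (1 : A) := by rw [mul_smul, ← hd, h1, inv_smul_smul₀ hc0]
    rw [this]; simp [Ring.lie_def]

theorem central_of_nest (m : ℕ) {u : A}
    (h : ∀ t : List A, t.length = m → ∃ c : K, nest u t = c • (1 : A)) :
    ∃ c : K, u = c • (1 : A) := by
  induction m generalizing u with
  | zero => simpa using h [] rfl
  | succ m ih =>
    exact S.central_of_bracket fun y => ih fun t ht => h (y :: t) (by simp [ht])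

/-- This and the next three lemmas record the eigenvalues of `u ↦ [u, e]`: `-1` on `eAf`, `1` on
`fAe`, `0` on the diagonal. -/
theorem nest_replicate_left_right (k : ℕ) (u : A) :
    e * nest u (List.replicate k e) * f = (-1) ^ k * (e * u * f) := by
  obtain ⟨h, -, -, -, h', -⟩ := S.peirce_left.facts S.mul_right S.mul_left
  induction k generalizing u with
  | zero => simp
  | succ k ih =>
    rw [List.replicate_succ, nest_cons, ih]
    simp [Ring.lie_def, mul_sub, sub_mul, mul_assoc, h', S.mul_left, pow_succ]

theorem nest_replicate_right_left (k : ℕ) (u : A) :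
    f * nest u (List.replicate k e) * e = f * u * e := by
  obtain ⟨h, -, h1, -, h', -, h2, -⟩ := S.peirce_left.facts S.mul_right S.mul_left
  induction k generalizing u with
  | zero => simp
  | succ k ih =>
    rw [List.replicate_succ, nest_cons, ih]
    simp [Ring.lie_def, mul_sub, mul_assoc, h, h2]

theorem nest_replicate_diag (k : ℕ) (u : A) :
    e * nest u (List.replicate (k + 1) e) * e = 0 ∧
      f * nest u (List.replicate (k + 1) e) * f = 0 := by
  obtain ⟨h, -, h1, -, h', -, h2, -⟩ := S.peirce_left.facts S.mul_right S.mul_left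
  induction k generalizing u with
  | zero => simp [Ring.lie_def, mul_sub, sub_mul, mul_assoc, h, h', h2, S.mul_left]
  | succ k ih => rw [List.replicate_succ, nest_cons]; exact ih _

theorem nest_replicate_of_peirce (k : ℕ) {x : A} (hx : Peirce e f x) :
    nest x (List.replicate k e) = (-1) ^ k * x := by
  obtain ⟨h1, h2, h3, h4, -⟩ := hx.facts S.mul_right S.mul_right
  -- The sign alternates at each step, so the induction carries it as a factor.
  have h : ∀ c : A, (c = 1 ∨ c = -1) → nest (c * x) (List.replicate k e) = (-1) ^ k * (c * x) := by
    induction k with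
    | zero => simp
    | succ k ih =>
      intro c hc
      rw [List.replicate_succ, nest_cons]
      have : ⁅c * x, e⁆ = -c * x := by
        rcases hc with rfl | rfl <;> simp [Ring.lie_def, h1, h4]
      rw [this, ih _ (by rcases hc with rfl | rfl <;> simp), pow_succ]
      simp
  simpa using h 1 (Or.inl rfl)

end IsPeircePair

/-! ### Leibniz rules obtained by padding with the idempotent -/

/-- If the map `δ` sends the idempotent `e` into the centre, then iterated commutators with `e`
do not contribute to `nestVar`. -/
theorem nestVar_replicate {δ : A →ₗ[K] A} {e : A} {c : K} (h : δ e = c • (1 : A)) (k : ℕ) (u : A) :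
    nestVar δ (List.replicate k e) u = 0 := by
  refine nestVar_eq_zero (fun d hd w => ?_) u
  rw [List.eq_of_mem_replicate hd, h]
  simp [Ring.lie_def]

theorem mul_map_neg_one_pow_mul (δ : A →ₗ[K] A) (m : ℕ) (e f w : A) :
    e * δ ((-1) ^ m * w) * f = (-1) ^ m * (e * δ w * f) := by
  rcases neg_one_pow_eq_or A m with h | h <;> simp [h]

/-- The data for the main argument: a weak Lie derivation mapping the two idempotents of a Peirce
pair into the centre. -/
structure IsAdapted (m : ℕ) (e f : A) (δ : A →ₗ[K] A) : Prop where
  pair : IsPeircePair K e f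
  weak : IsWeakLieDerivation m δ
  map_left : ∃ c : K, δ e = c • (1 : A)
  map_right : ∃ c : K, δ f = c • (1 : A)

theorem IsWeakLieDerivation.bracket_central {m : ℕ} {e f : A} {δ : A →ₗ[K] A}
    (hδ : IsWeakLieDerivation m δ) (S : IsPeircePair K e f) {x y : A} (h : ⁅x, y⁆ = 0) :
    ∃ c : K, ⁅δ x, y⁆ + ⁅x, δ y⁆ = c • (1 : A) := by
  refine S.central_of_nest m fun t ht => ?_
  obtain ⟨c, hc⟩ := hδ x (y :: t) (by simp [ht])
  rw [nest_cons, h, nest_zero, map_zero, nestVar_cons, h, nestVar_zero, nest_cons, add_zero,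
    ← nest_add] at hc
  exact ⟨-c, by rw [neg_smul]; exact eq_neg_of_add_eq_zero_left hc.symm⟩

namespace IsAdapted

variable {m : ℕ} {e f : A} {δ : A →ₗ[K] A} (D : IsAdapted m e f δ)
include D

theorem symm : IsAdapted m f e δ := ⟨D.pair.symm, D.weak, D.map_right, D.map_left⟩

/-- Pad with `m` copies of `e`. In the `eAf` component both sides acquire `(-1) ^ m`, which cancels,
and the scalar error disappears because `ef = 0`. -/
theorem bracket_left_right {x y : A} (h : Peirce e f ⁅x, y⁆) :
    e * δ ⁅x, y⁆ * f = e * (⁅δ x, y⁆ + ⁅x, δ y⁆) * f := by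
  obtain ⟨a, ha⟩ := D.map_left
  obtain ⟨c, hc⟩ := D.weak x (y :: List.replicate m e) (by simp)
  rw [nest_cons, nestVar_cons, nestVar_replicate ha, add_zero, nest_cons, ← nest_add,
    D.pair.nest_replicate_of_peirce _ h] at hc
  have := congrArg (fun w => e * w * f) hc
  simp only [mul_add, add_mul, D.pair.nest_replicate_left_right, mul_smul_comm, smul_mul_assoc,
    mul_one, D.pair.mul_left, smul_zero, add_zero] at this
  rw [mul_map_neg_one_pow_mul] at this
  refine (isUnit_one.neg.pow m).mul_left_cancel ?_
  simpa only [mul_add, add_mul] using this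

/-- Here the padding fixes the right-hand side, while `[x, y]`, lying in `eAf`, still acquires a
sign under `δ`. This surviving sign is what `cross_eq_zero` exploits. -/
theorem bracket_right_left {x y : A} (h : Peirce e f ⁅x, y⁆) :
    (-1) ^ m * (f * δ ⁅x, y⁆ * e) = f * (⁅δ x, y⁆ + ⁅x, δ y⁆) * e := by
  obtain ⟨a, ha⟩ := D.map_left
  obtain ⟨c, hc⟩ := D.weak x (y :: List.replicate m e) (by simp)
  rw [nest_cons, nestVar_cons, nestVar_replicate ha, add_zero, nest_cons, ← nest_add,
    D.pair.nest_replicate_of_peirce _ h] at hc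
  have := congrArg (fun w => f * w * e) hc
  simp only [mul_add, add_mul, D.pair.nest_replicate_right_left, mul_smul_comm, smul_mul_assoc,
    mul_one, D.pair.mul_right, smul_zero, add_zero] at this
  rw [mul_map_neg_one_pow_mul] at this
  simpa only [mul_add, add_mul] using this

end IsAdapted

namespace IsAdapted

variable {m : ℕ} {e f : A} {δ : A →ₗ[K] A} (D : IsAdapted (m + 1) e f δ)
include D

theorem bracket_bracket_left_right {x y z : A} (h : Peirce e f ⁅⁅x, y⁆, z⁆) :
    e * δ ⁅⁅x, y⁆, z⁆ * f = e * (⁅⁅δ x, y⁆, z⁆ + ⁅⁅x, δ y⁆, z⁆ + ⁅⁅x, y⁆, δ z⁆) * f := by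
  obtain ⟨a, ha⟩ := D.map_left
  obtain ⟨c, hc⟩ := D.weak x (y :: z :: List.replicate m e) (by simp)
  rw [nest_cons, nest_cons, nestVar_cons, nestVar_cons, nestVar_replicate ha, add_zero, nest_cons,
    nest_cons, nest_cons, ← add_assoc, ← nest_add, ← nest_add,
    D.pair.nest_replicate_of_peirce _ h] at hc
  have := congrArg (fun w => e * w * f) hc
  simp only [mul_add, add_mul, D.pair.nest_replicate_left_right, mul_smul_comm, smul_mul_assoc,
    mul_one, D.pair.mul_left, smul_zero, add_zero] at this
  rw [mul_map_neg_one_pow_mul] at this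
  refine (isUnit_one.neg.pow m).mul_left_cancel ?_
  simpa only [mul_add, add_mul, add_assoc] using this

theorem bracket_bracket_right_left {x y z : A} (h : Peirce e f ⁅⁅x, y⁆, z⁆) :
    (-1) ^ m * (f * δ ⁅⁅x, y⁆, z⁆ * e) =
      f * (⁅⁅δ x, y⁆, z⁆ + ⁅⁅x, δ y⁆, z⁆ + ⁅⁅x, y⁆, δ z⁆) * e := by
  obtain ⟨a, ha⟩ := D.map_left
  obtain ⟨c, hc⟩ := D.weak x (y :: z :: List.replicate m e) (by simp)
  rw [nest_cons, nest_cons, nestVar_cons, nestVar_cons, nestVar_replicate ha, add_zero, nest_cons,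
    nest_cons, nest_cons, ← add_assoc, ← nest_add, ← nest_add,
    D.pair.nest_replicate_of_peirce _ h] at hc
  have := congrArg (fun w => f * w * e) hc
  simp only [mul_add, add_mul, D.pair.nest_replicate_right_left, mul_smul_comm, smul_mul_assoc,
    mul_one, D.pair.mul_right, smul_zero, add_zero] at this
  rw [mul_map_neg_one_pow_mul] at this
  simpa only [mul_add, add_mul, add_assoc] using this

end IsAdapted

theorem Peirce.mul {e f g x y : A} (hx : Peirce e f x) (hy : Peirce f g y) : Peirce e g (x * y) :=
  ⟨by rw [← mul_assoc, hx.1], by rw [mul_assoc, hy.2]⟩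

theorem Peirce.add {e f x y : A} (hx : Peirce e f x) (hy : Peirce e f y) : Peirce e f (x + y) :=
  ⟨by rw [mul_add, hx.1, hy.1], by rw [add_mul, hx.2, hy.2]⟩

namespace IsPeircePair

variable {e f : A} (S : IsPeircePair K e f)
include S

theorem bracket_left_left {a x : A} (ha : Peirce e e a) (hx : Peirce e f x) : ⁅a, x⁆ = a * x := by
  obtain ⟨-, -, -, -, -, -, -, h⟩ := hx.facts S.mul_right S.mul_right
  rw [Ring.lie_def, ← ha.1, mul_assoc e, h, sub_zero]

theorem bracket_right_right {b x : A} (hb : Peirce f f b) (hx : Peirce e f x) :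
    ⁅x, b⁆ = x * b := by
  rw [Ring.lie_def, ← hb.2, mul_assoc b, hx.facts S.mul_right S.mul_right |>.2.2.1, mul_zero,
    sub_zero]

theorem bracket_bracket {x y z : A} (hx : Peirce e f x) (_ : Peirce f e y) (hz : Peirce e f z) :
    ⁅⁅x, y⁆, z⁆ = x * y * z + z * y * x := by
  obtain ⟨-, -, h1, h2, -⟩ := hx.facts S.mul_right S.mul_right
  obtain ⟨-, -, h3, h4, -, -, -, h5⟩ := hz.facts S.mul_right S.mul_right
  have h6 : x * z = 0 := by rw [← hx.2, mul_assoc, h3, mul_zero]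
  have h7 : z * x = 0 := by rw [← hx.1, h5]
  simp only [Ring.lie_def, sub_mul, mul_sub, mul_assoc, h6, mul_zero]
  rw [← mul_assoc z x, h7]; simp

theorem peirce_of_components {x : A} (h1 : e * x * e = 0) (h3 : f * x * e = 0)
    (h4 : f * x * f = 0) : Peirce e f x := by
  have := S.decomposition x
  rw [h1, h3, h4, zero_add, add_zero, add_zero] at this
  rw [this]; exact S.peirce_left_right x

theorem peirce_of_components' {x : A} (h1 : e * x * f = 0) (h3 : f * x * e = 0)
    (h4 : f * x * f = 0) : Peirce e e x := by
  have := S.decomposition x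
  rw [h1, h3, h4, add_zero, add_zero, add_zero] at this
  rw [this]; exact S.peirce_left_left x

theorem exists_smul_of_bracket {u : A} (hu : Peirce f f u)
    (h : ∀ b, Peirce f f b → ∃ c : K, ⁅u, b⁆ = c • f) : ∃ c : K, u = c • f := by
  refine S.corner_right u hu fun b hb => ?_
  obtain ⟨c, hc⟩ := h b hb
  obtain ⟨d, hd⟩ := h (u * b) (hu.mul hb)
  have h1 : ⁅u, u * b⁆ = u * ⁅u, b⁆ := by simp only [Ring.lie_def, mul_sub, mul_assoc]
  rw [hc, mul_smul_comm, hu.2] at h1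
  rw [← sub_eq_zero, ← Ring.lie_def]
  by_cases hc0 : c = 0
  · rw [hc, hc0, zero_smul]
  · have : u = (c⁻¹ * d) • f := by rw [mul_smul, ← hd, h1, inv_smul_smul₀ hc0]
    rw [this]; simp [Ring.lie_def, hb.1, hb.2]

end IsPeircePair

/-! ### Action of an adapted map on the Peirce components -/

/-- The identity defining Lie derivations in `m + 2` variables, in terms of lists. -/
def IsListLieDerivation (m : ℕ) (δ : A →ₗ[K] A) : Prop :=
  ∀ (u : A) (t : List A), t.length = m + 1 → δ (nest u t) = nest (δ u) t + nestVar δ t u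

namespace IsAdapted

variable {m : ℕ} {e f : A} {δ : A →ₗ[K] A} (D : IsAdapted m e f δ)
include D

/-- Put `φ(x) = f δ(x) e`. For even `m`, `x = [e, x]` gives `φ(x) = -φ(x)`. For odd `m`, `φ`
reverses the bimodule structure: `φ(ax) = φ(x)a` and `φ(xb) = bφ(x)`. Writing `φ` for `φ(x)`,
comparing both sides on `[[w, φ], x]` gives `4φwφ = 0` for all `w` in `eAf`, and primeness applies.
-/
theorem cross_eq_zero [CharZero K] {x : A} (hx : Peirce e f x) : f * δ x * e = 0 := by
  have S := D.pair
  have hφ : ∀ x, Peirce f e (f * δ x * e) := fun x => S.symm.peirce_left_right (δ x)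
  have two : ∀ w : A, w + w = 0 → w = 0 := fun w hw => by
    rw [← two_smul K w] at hw
    exact (smul_eq_zero.1 hw).resolve_left two_ne_zero
  rcases Nat.even_or_odd m with hm | hm
  · obtain ⟨c, hc⟩ := D.map_left
    have h1 : ⁅e, x⁆ = x := by rw [S.bracket_left_left S.peirce_left hx, hx.1]
    have := D.bracket_right_left (x := e) (y := x) (by rwa [h1])
    rw [h1, hm.neg_one_pow, hc] at this
    have h2 := (S.peirce_left.facts S.mul_right S.mul_left).1
    have h3 := S.mul_right
    simp only [Ring.lie_def, one_mul, mul_sub, smul_mul_assoc, mul_one,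
      mul_smul_comm, sub_self, zero_add, ← mul_assoc, h3, zero_mul, zero_sub] at this
    rw [neg_mul, mul_assoc (f * δ x), h2] at this
    exact two _ (by nth_rewrite 1 [this]; simp)
  · obtain ⟨k, rfl⟩ : ∃ k, m = k + 1 := ⟨m - 1, by have := hm.pos; omega⟩
    have hk : (-1 : A) ^ k = 1 := Even.neg_one_pow (by simpa [Nat.odd_add_one] using hm)
    have hl : ∀ a x, Peirce e e a → Peirce e f x → f * δ (a * x) * e = f * δ x * e * a := by
      intro a x ha hx
      have h1 := S.bracket_left_left ha hx
      have := D.bracket_right_left (x := a) (y := x) (by rw [h1]; exact ha.mul hx)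
      obtain ⟨a1, a2, a3, a4, a5, a6, a7, a8⟩ := ha.facts S.mul_right S.mul_left
      obtain ⟨x1, x2, x3, x4, x5, x6, x7, x8⟩ := hx.facts S.mul_right S.mul_right
      rw [h1, hm.neg_one_pow] at this
      simp only [Ring.lie_def, mul_add, add_mul, mul_sub, mul_assoc, a2, a7, x4, x7,
        mul_zero, neg_mul, one_mul, sub_zero, zero_sub, zero_add, neg_inj] at this
      simp only [mul_assoc, this, a1]
    have hr : ∀ b x, Peirce f f b → Peirce e f x → f * δ (x * b) * e = b * (f * δ x * e) := by
      intro b x hb hx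
      have h1 := S.bracket_right_right hb hx
      have := D.bracket_right_left (x := x) (y := b) (by rw [h1]; exact hx.mul hb)
      obtain ⟨a1, a2, a3, a4, a5, a6, a7, a8⟩ := hb.facts S.mul_left S.mul_right
      obtain ⟨x1, x2, x3, x4, x5, x6, x7, x8⟩ := hx.facts S.mul_right S.mul_right
      rw [h1, hm.neg_one_pow] at this
      simp only [Ring.lie_def, mul_add, add_mul, mul_sub, sub_mul, mul_assoc, a4, a5, x4, x7,
        mul_zero, neg_mul, one_mul, zero_sub, neg_zero, neg_inj, add_zero] at this
      simp only [mul_assoc, this, a6]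
    refine (or_self_iff.1 (S.prime _ _ fun a => ?_))
    obtain ⟨φ, hφx⟩ : ∃ φ, f * δ x * e = φ := ⟨_, rfl⟩
    have hy : Peirce f e φ := hφx ▸ hφ x
    have hw := S.peirce_left_right a
    have ha : φ * a * φ = φ * (e * a * f) * φ := by
      simp only [← mul_assoc]
      rw [hy.2, mul_assoc _ f φ, hy.1]
    rw [hφx, ha]
    generalize e * a * f = w at hw
    have hb := S.bracket_bracket hw hy hx
    have := D.bracket_bracket_right_left (x := w) (y := φ) (z := x)
      (by rw [hb]; exact ((hw.mul hy).mul hx).add ((hx.mul hy).mul hw))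
    obtain ⟨x1, x2, x3, x4, x5, x6, x7, x8⟩ := hx.facts S.mul_right S.mul_right
    obtain ⟨w1, w2, w3, w4, w5, w6, w7, w8⟩ := hw.facts S.mul_right S.mul_right
    obtain ⟨y1, y2, y3, y4, y5, y6, y7, y8⟩ := hy.facts S.mul_left S.mul_left
    have h0 : ∀ g : A, f * ⁅g, x⁆ * e = 0 := fun g => by
      simp only [Ring.lie_def, mul_sub, mul_assoc, x4, x7, mul_zero, sub_zero]
    have h1 : f * ⁅⁅w, φ⁆, δ x⁆ * e = -(φ * w * φ + φ * w * φ) := by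
      have e1 : w * (δ x * e) = w * φ := by rw [← hφx]; simp only [mul_assoc, w6]
      have e2 : f * (δ x * (w * φ)) = φ * (w * φ) := by
        have : f * (δ x * (w * φ)) = f * δ x * e * (w * φ) := by simp only [mul_assoc, w5]
        rw [this, hφx]
      simp only [Ring.lie_def, mul_sub, sub_mul, mul_assoc, w4, w7, y2, y5, zero_mul, mul_zero, e1, e2]
      abel
    rw [hb, hk, one_mul, mul_add, mul_add, add_mul, add_mul, h0, h0, h1, map_add, mul_add, add_mul,
      hl _ _ (hw.mul hy) hx, mul_assoc x, hr _ _ (hy.mul hw) hx, hφx, zero_add,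
      zero_add, ← mul_assoc] at this
    refine two _ (two _ ?_)
    nth_rewrite 1 [this]
    simp

/-- A Lie derivation mapping `e` and `f` into the centre preserves `eAf`. -/
theorem map_left_right [CharZero K] (hδ : IsListLieDerivation m δ) {x : A} (hx : Peirce e f x) :
    Peirce e f (δ x) := by
  have S := D.pair
  obtain ⟨c, hc⟩ := D.map_left
  have := hδ x (List.replicate (m + 1) e) (by simp)
  rw [nestVar_replicate hc, add_zero, S.nest_replicate_of_peirce _ hx] at this
  obtain ⟨h1, h2⟩ := S.nest_replicate_diag m (δ x)
  rw [← this, mul_map_neg_one_pow_mul] at h1 h2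
  have hu := (isUnit_one (M := A)).neg.pow (m + 1)
  exact S.peirce_of_components (hu.mul_right_eq_zero.1 h1) (D.cross_eq_zero hx)
    (hu.mul_right_eq_zero.1 h2)

/-- The off-diagonal parts vanish because `[a, e] = 0`. Since `a` also commutes with `fAf`, the
brackets of `f δ(a) f` with `fAf` are multiples of `f`, which puts it in the scalar centre of that
corner. -/
theorem map_left_left {a : A} (ha : Peirce e e a) :
    e * δ a * f = 0 ∧ f * δ a * e = 0 ∧ ∃ c : K, f * δ a * f = c • f := by
  have S := D.pair
  obtain ⟨e1, -, e3, -, e5, -, e7, -⟩ := S.peirce_left.facts S.mul_right S.mul_left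
  obtain ⟨f1, -, f3, -, f5, -, f7, -⟩ := S.peirce_right.facts S.mul_left S.mul_right
  obtain ⟨a1, a2, a3, a4, a5, a6, a7, a8⟩ := ha.facts S.mul_right S.mul_left
  have hae : ⁅a, e⁆ = 0 := by rw [Ring.lie_def, a1, a2, sub_self]
  obtain ⟨c, hc⟩ := D.map_left
  obtain ⟨d, hd⟩ := D.weak.bracket_central S hae
  have h0 : ⁅a, δ e⁆ = 0 := by rw [hc]; simp [Ring.lie_def]
  rw [h0, add_zero] at hd
  have hef := congrArg (fun w => e * w * f) hd
  have hfe := congrArg (fun w => f * w * e) hd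
  simp only [Ring.lie_def, mul_sub, sub_mul, mul_assoc, f3, e5, mul_zero, zero_sub, mul_smul_comm,
    smul_mul_assoc, one_mul, smul_zero, neg_eq_zero] at hef
  simp only [Ring.lie_def, mul_sub, mul_assoc, e1, e3, e7, sub_zero, mul_smul_comm,
    smul_mul_assoc, one_mul, smul_zero] at hfe
  refine ⟨by rw [mul_assoc, hef], by rw [mul_assoc, hfe],
    S.exists_smul_of_bracket (S.symm.peirce_left_left _) fun b hb => ?_⟩
  obtain ⟨b1, b2, b3, b4, b5, b6, b7, b8⟩ := hb.facts S.mul_left S.mul_right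
  have hab : ⁅a, b⁆ = 0 := by
    rw [Ring.lie_def, ← a2, mul_assoc, b3, ← b2, mul_assoc b, ← mul_assoc f, a3]; simp
  obtain ⟨k, hk⟩ := D.weak.bracket_central S hab
  refine ⟨k, ?_⟩
  have := congrArg (fun w => f * w * f) hk
  simp only [Ring.lie_def, mul_add, add_mul, mul_sub, sub_mul, mul_assoc, a7, a4, b2, b5,
    mul_zero, sub_zero, zero_mul, add_zero, mul_smul_comm, smul_mul_assoc, one_mul, f1] at this
  simpa only [Ring.lie_def, mul_assoc, b1, b2, b5, b6, mul_zero, sub_zero] using this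

end IsAdapted

/-! ### Leibniz rule, component by component -/

theorem Peirce.mul_eq_zero {e f g k x y : A} (hx : Peirce e f x) (hy : Peirce g k y)
    (h : f * g = 0) : x * y = 0 := by
  rw [← hx.2, ← hy.1, mul_assoc, ← mul_assoc f, h, zero_mul, mul_zero]

theorem Peirce.compress {e f x : A} (hx : Peirce e f x) : e * x * f = x := by rw [hx.1, hx.2]

/-- The linear map `h` preserves all components of the Peirce decomposition. -/
structure PreservesPeirce (e f : A) (h : A →ₗ[K] A) : Prop where
  ll : ∀ {x}, Peirce e e x → Peirce e e (h x)
  lr : ∀ {x}, Peirce e f x → Peirce e f (h x)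
  rl : ∀ {x}, Peirce f e x → Peirce f e (h x)
  rr : ∀ {x}, Peirce f f x → Peirce f f (h x)

theorem PreservesPeirce.symm {e f : A} {h : A →ₗ[K] A} (H : PreservesPeirce e f h) :
    PreservesPeirce f e h := ⟨H.rr, H.rl, H.lr, H.ll⟩

namespace IsAdapted

variable {m : ℕ} {e f : A} {h : A →ₗ[K] A} (D : IsAdapted m e f h) (H : PreservesPeirce e f h)
include D H

theorem map_mul_ll_lr {a x : A} (ha : Peirce e e a) (hx : Peirce e f x) :
    h (a * x) = h a * x + a * h x := by
  have S := D.pair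
  have h1 := S.bracket_left_left ha hx
  have := D.bracket_left_right (x := a) (y := x) (by rw [h1]; exact ha.mul hx)
  rw [h1, S.bracket_left_left (H.ll ha) hx, S.bracket_left_left ha (H.lr hx)] at this
  rwa [(H.lr (ha.mul hx)).compress, (((H.ll ha).mul hx).add (ha.mul (H.lr hx))).compress] at this

theorem map_mul_lr_rr {x b : A} (hx : Peirce e f x) (hb : Peirce f f b) :
    h (x * b) = h x * b + x * h b := by
  have S := D.pair
  have h1 := S.bracket_right_right hb hx
  have := D.bracket_left_right (x := x) (y := b) (by rw [h1]; exact hx.mul hb)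
  rw [h1, S.bracket_right_right (H.rr hb) hx, S.bracket_right_right hb (H.lr hx)] at this
  rwa [(H.lr (hx.mul hb)).compress, (((H.lr hx).mul hb).add (hx.mul (H.rr hb))).compress] at this

/-- Expand `h(abx)` in two ways for `x` in `eAf`, then use faithfulness. -/
theorem map_mul_ll_ll {a b : A} (ha : Peirce e e a) (hb : Peirce e e b) :
    h (a * b) = h a * b + a * h b := by
  have hab := ha.mul hb
  rw [← sub_eq_zero]
  refine D.pair.eq_zero_of_mul_left ?_ fun x hx => ?_
  · rw [sub_mul, (H.ll hab).2, (((H.ll ha).mul hb).add (ha.mul (H.ll hb))).2]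
  · have h1 := D.map_mul_ll_lr H hab hx
    rw [mul_assoc, D.map_mul_ll_lr H ha (hb.mul hx), D.map_mul_ll_lr H hb hx] at h1
    rw [sub_mul, add_mul, ← sub_eq_zero.2 h1.symm]
    noncomm_ring

/-- The two defects intertwine `eAf`. For `m = 0` their sum is scalar by the weak identity for `[x,
y]`; otherwise the rule for `[[x, y], z]` with `z` in `eAf` is used. -/
theorem exists_defect {x y : A} (hx : Peirce e f x) (hy : Peirce f e y) :
    ∃ c : K, h (x * y) - (h x * y + x * h y) = c • e ∧
      -(h (y * x) - (h y * x + y * h x)) = c • f := by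
  have S := D.pair
  have hu : Peirce e e (h (x * y) - (h x * y + x * h y)) := by
    have h1 := H.ll (hx.mul hy)
    have h2 := ((H.lr hx).mul hy).add (hx.mul (H.rl hy))
    exact ⟨by rw [mul_sub, h1.1, h2.1], by rw [sub_mul, h1.2, h2.2]⟩
  have hv : Peirce f f (-(h (y * x) - (h y * x + y * h x))) := by
    have h1 := H.rr (hy.mul hx)
    have h2 := ((H.rl hy).mul hx).add (hy.mul (H.lr hx))
    exact ⟨by rw [mul_neg, mul_sub, h1.1, h2.1], by rw [neg_mul, sub_mul, h1.2, h2.2]⟩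
  refine S.exists_smul_of_intertwine hu hv fun z hz => ?_
  rw [← sub_eq_zero]
  cases m with
  | zero =>
    obtain ⟨c, hc⟩ := D.weak x [y] rfl
    simp only [nest_cons, nest_nil, nestVar_cons, nestVar_nil, add_zero, Ring.lie_def,
      map_sub] at hc
    have huv : h (x * y) - (h x * y + x * h y) + -(h (y * x) - (h y * x + y * h x)) =
        c • (1 : A) := by
      rw [← sub_eq_iff_eq_add'.2 hc]; abel
    have h1 := congrArg (· * z) huv
    have h2 := congrArg (z * ·) huv
    simp only [add_mul _ _ z, mul_add z, hv.mul_eq_zero hz S.mul_right,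
      hz.mul_eq_zero hu S.mul_right, add_zero, zero_add, smul_mul_assoc, mul_smul_comm, one_mul,
      mul_one] at h1 h2
    rw [h1, h2, sub_self]
  | succ m =>
    have h1 := D.bracket_bracket_left_right (x := x) (y := y) (z := z) (by
      rw [S.bracket_bracket hx hy hz]
      exact ((hx.mul hy).mul hz).add ((hz.mul hy).mul hx))
    rw [S.bracket_bracket hx hy hz, S.bracket_bracket (H.lr hx) hy hz,
      S.bracket_bracket hx (H.rl hy) hz, S.bracket_bracket hx hy (H.lr hz)] at h1
    rw [(H.lr (((hx.mul hy).mul hz).add ((hz.mul hy).mul hx))).compress, Peirce.compress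
      (((((H.lr hx).mul hy).mul hz).add ((hz.mul hy).mul (H.lr hx))).add
      (((hx.mul (H.rl hy)).mul hz).add ((hz.mul (H.rl hy)).mul hx)) |>.add
      (((hx.mul hy).mul (H.lr hz)).add (((H.lr hz).mul hy).mul hx))), map_add,
      D.map_mul_ll_lr H (hx.mul hy) hz, mul_assoc z y x,
      D.map_mul_lr_rr H hz (hy.mul hx)] at h1
    rw [← sub_eq_zero.2 h1]
    noncomm_ring

end IsAdapted

theorem IsAdapted.map_mul_lr_rl {m : ℕ} [CharZero K] {e f : A} {h : A →ₗ[K] A}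
    (D : IsAdapted m e f h)
    (H : PreservesPeirce e f h) {x y : A} (hx : Peirce e f x) (hy : Peirce f e y) :
    h (x * y) = h x * y + x * h y := by
  obtain ⟨c, hc, hd⟩ := D.exists_defect H hx hy
  by_cases hx0 : x = 0
  · simp [hx0]
  have h1 := D.map_mul_ll_lr H (hx.mul hy) hx
  have h2 := D.map_mul_lr_rr H hx (hy.mul hx)
  -- Expanding `h((xy)x)` and `h(x(yx))` yields errors `c • x` and `-c • x`.
  have h3 : (c + c) • x = 0 := by
    have e1 : (c • e) * x = c • x := by rw [smul_mul_assoc, hx.1]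
    have e2 : x * (c • f) = c • x := by rw [mul_smul_comm, hx.2]
    rw [add_smul]
    nth_rewrite 1 [← e1]
    rw [← e2, ← hc, ← hd]
    rw [mul_assoc, h2] at h1
    rw [← sub_eq_zero.2 h1.symm]
    noncomm_ring
  have h4 : c = 0 := by
    simpa using (smul_eq_zero.1 h3).resolve_right hx0
  rwa [h4, zero_smul, sub_eq_zero] at hc

theorem IsAdapted.isDerivation {m : ℕ} [CharZero K] {e f : A} {h : A →ₗ[K] A}
    (D : IsAdapted m e f h) (H : PreservesPeirce e f h) : IsDerivation h := by
  have S := D.pair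
  have orth : ∀ {e f g k x y : A}, Peirce e f x → Peirce g k y → Peirce e f (h x) →
      Peirce g k (h y) → f * g = 0 → h (x * y) = h x * y + x * h y := by
    intro e f g k x y hx hy hx' hy' h0
    rw [hx.mul_eq_zero hy h0, hx'.mul_eq_zero hy h0, hx.mul_eq_zero hy' h0, map_zero, add_zero]
  intro x y
  induction x using S.induction with
  | add x x' hx hx' => rw [add_mul, map_add, map_add, hx, hx', add_mul, add_mul]; abel
  | hee x hx =>
    induction y using S.induction with
    | add y y' hy hy' => rw [mul_add, map_add, map_add, hy, hy', mul_add, mul_add]; abel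
    | hee y hy => exact D.map_mul_ll_ll H hx hy
    | hef y hy => exact D.map_mul_ll_lr H hx hy
    | hfe y hy => exact orth hx hy (H.ll hx) (H.rl hy) S.mul_left
    | hff y hy => exact orth hx hy (H.ll hx) (H.rr hy) S.mul_left
  | hef x hx =>
    induction y using S.induction with
    | add y y' hy hy' => rw [mul_add, map_add, map_add, hy, hy', mul_add, mul_add]; abel
    | hee y hy => exact orth hx hy (H.lr hx) (H.ll hy) S.mul_right
    | hef y hy => exact orth hx hy (H.lr hx) (H.lr hy) S.mul_right
    | hfe y hy => exact D.map_mul_lr_rl H hx hy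
    | hff y hy => exact D.map_mul_lr_rr H hx hy
  | hfe x hx =>
    induction y using S.induction with
    | add y y' hy hy' => rw [mul_add, map_add, map_add, hy, hy', mul_add, mul_add]; abel
    | hee y hy => exact D.symm.map_mul_lr_rr H.symm hx hy
    | hef y hy => exact D.symm.map_mul_lr_rl H.symm hx hy
    | hfe y hy => exact orth hx hy (H.rl hx) (H.rl hy) S.mul_left
    | hff y hy => exact orth hx hy (H.rl hx) (H.rr hy) S.mul_left
  | hff x hx =>
    induction y using S.induction with
    | add y y' hy hy' => rw [mul_add, map_add, map_add, hy, hy', mul_add, mul_add]; abel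
    | hee y hy => exact orth hx hy (H.rr hx) (H.ll hy) S.mul_right
    | hef y hy => exact orth hx hy (H.rr hx) (H.lr hy) S.mul_right
    | hfe y hy => exact D.symm.map_mul_ll_lr H.symm hx hy
    | hff y hy => exact D.symm.map_mul_ll_ll H.symm hx hy

/-! ### Reduction to a map preserving the Peirce components -/

/-- A linear left inverse of `c ↦ c • f` turns the pointwise coefficients into a linear functional.
-/
theorem exists_functional {f : A} (hf : f ≠ 0) (g : A →ₗ[K] A) (h : ∀ x, ∃ c : K, g x = c • f) :
    ∃ l : A →ₗ[K] K, ∀ x, g x = l x • f := by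
  obtain ⟨φ, hφ⟩ := LinearMap.exists_leftInverse_of_injective (LinearMap.toSpanSingleton K A f)
    (LinearMap.ker_toSpanSingleton K hf)
  have hφf : φ f = 1 := by simpa using LinearMap.congr_fun hφ 1
  refine ⟨φ ∘ₗ g, fun x => ?_⟩
  obtain ⟨c, hc⟩ := h x
  simp [hc, hφf]

theorem IsListLieDerivation.isWeak {m : ℕ} {δ : A →ₗ[K] A} (hδ : IsListLieDerivation m δ) :
    IsWeakLieDerivation m δ := fun u t ht => ⟨0, by rw [hδ u t ht, zero_smul, add_zero]⟩

theorem IsListLieDerivation.sub {m : ℕ} {δ ε : A →ₗ[K] A} (hδ : IsListLieDerivation m δ)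
    (hε : IsListLieDerivation m ε) : IsListLieDerivation m (δ - ε) := by
  intro u t ht
  have h1 : nest (δ u) t = nest ((δ - ε) u) t + nest (ε u) t := by rw [← nest_add]; simp
  have h2 : nestVar δ t u = nestVar (δ - ε) t u + nestVar ε t u := by
    rw [← nestVar_add]; simp
  rw [LinearMap.sub_apply, hδ u t ht, hε u t ht, h1, h2]
  abel

theorem IsDerivation.isList {d : A →ₗ[K] A} (hd : IsDerivation d) (m : ℕ) :
    IsListLieDerivation m d := fun u t _ => hd.map_nest u t

/-- The inner derivation `x ↦ x * s - s * x`. -/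
def innerDer (K : Type*) {A : Type*} [Field K] [Ring A] [Algebra K A] (s : A) : A →ₗ[K] A :=
  LinearMap.mulRight K s - LinearMap.mulLeft K s

@[simp] theorem innerDer_apply (s x : A) : innerDer K s x = x * s - s * x := rfl

theorem isDerivation_innerDer (s : A) : IsDerivation (innerDer K s) := by
  intro x y
  simp only [innerDer_apply]
  noncomm_ring

/-- Maps that differ by a central map have the same iterated commutator expansions. -/
theorem expansion_congr {δ h : A →ₗ[K] A} {l : A →ₗ[K] K} (hl : ∀ x, h x = δ x - l x • (1 : A))
    (u c : A) (t : List A) :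
    nest (h u) (c :: t) + nestVar h (c :: t) u = nest (δ u) (c :: t) + nestVar δ (c :: t) u := by
  congr 1
  · rw [nest_cons, nest_cons, hl]; simp [Ring.lie_def, sub_mul, mul_sub]
  · exact nestVar_congr (fun c _ w => by rw [hl]; simp [Ring.lie_def, sub_mul, mul_sub]) u

namespace IsPeircePair

variable {e f : A} (S : IsPeircePair K e f)
include S

theorem nestVar_replicate_of_peirce {δ : A → A} {x : A} (k : ℕ) (hx : Peirce e f x)
    (hd : Peirce e f ⁅x, δ e⁆) :
    nestVar δ (List.replicate (k + 1) e) x = (k + 1) • ((-1) ^ k * ⁅x, δ e⁆) := by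
  obtain ⟨h1, h2, h3, h4, -⟩ := hx.facts S.mul_right S.mul_right
  have hxe : ⁅x, e⁆ = -x := by rw [Ring.lie_def, h1, h4, zero_sub]
  induction k generalizing x with
  | zero => simp
  | succ k ih =>
    have hneg : ⁅-x, δ e⁆ = -⁅x, δ e⁆ := by simp only [Ring.lie_def]; noncomm_ring
    rw [List.replicate_succ, nestVar_cons, S.nest_replicate_of_peirce _ hd, hxe]
    rw [ih (x := -x), hneg, succ_nsmul _ (k + 1), pow_succ, add_comm]
    · simp
    · exact ⟨by rw [mul_neg, h1], by rw [neg_mul, h2]⟩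
    · rw [hneg]; exact ⟨by rw [mul_neg, hd.1], by rw [neg_mul, hd.2]⟩
    · rw [mul_neg, h1]
    · rw [neg_mul, h2]
    · rw [mul_neg, h3, neg_zero]
    · rw [neg_mul, h4, neg_zero]
    · simp [Ring.lie_def, h1, h4]

/-- On `x, e, …, e` with `x` in `eAf`, the `eAf` component leaves `(m + 1)(-1) ^ m [x, δ e] = 0`. In
characteristic zero the diagonal parts of `δ e` therefore intertwine `eAf`. -/
theorem map_left_central [CharZero K] {m : ℕ} {δ : A →ₗ[K] A} (hδ : IsListLieDerivation m δ)
    (h₁ : e * δ e * f = 0) (h₂ : f * δ e * e = 0) : ∃ c : K, δ e = c • (1 : A) := by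
  have hd := S.decomposition (δ e)
  rw [h₁, h₂, add_zero, add_zero] at hd
  rw [hd]
  have hu := S.peirce_left_left (δ e)
  have hv := S.symm.peirce_left_left (δ e)
  refine S.exists_smul_one_of_intertwine hu hv fun x hx => ?_
  have hb : ⁅x, δ e⁆ = x * (f * δ e * f) - e * δ e * e * x := by
    rw [Ring.lie_def, hd, mul_add, add_mul, hx.mul_eq_zero hu S.mul_right,
      hv.mul_eq_zero hx S.mul_right, zero_add, add_zero, ← hd]
  have hp : Peirce e f ⁅x, δ e⁆ := by
    rw [hb]
    have h3 := hx.mul hv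
    have h4 := hu.mul hx
    exact ⟨by rw [mul_sub, h3.1, h4.1], by rw [sub_mul, h3.2, h4.2]⟩
  have h5 := hδ x (List.replicate (m + 1) e) (by simp)
  rw [S.nest_replicate_of_peirce _ hx, S.nestVar_replicate_of_peirce m hx hp] at h5
  have h6 := congrArg (fun w => e * w * f) h5
  have h7 : e * ((-1) ^ m * ⁅x, δ e⁆) * f = (-1) ^ m * ⁅x, δ e⁆ := by
    have := mul_map_neg_one_pow_mul (K := K) LinearMap.id m e f ⁅x, δ e⁆
    simpa only [LinearMap.id_apply, hp.compress] using this
  simp only [mul_map_neg_one_pow_mul, mul_add, add_mul, S.nest_replicate_left_right,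
    mul_smul_comm, smul_mul_assoc, h7, left_eq_add] at h6
  rw [← Nat.cast_smul_eq_nsmul K, smul_eq_zero] at h6
  have h8 := h6.resolve_left (Nat.cast_ne_zero.2 m.succ_ne_zero)
  have h9 := (isUnit_one (M := A)).neg.pow m |>.mul_right_eq_zero.1 h8
  rw [hb, sub_eq_zero] at h9
  exact h9.symm

theorem map_one_central {m : ℕ} {δ : A →ₗ[K] A} (hδ : IsWeakLieDerivation m δ) :
    ∃ c : K, δ 1 = c • (1 : A) := by
  refine S.central_of_bracket fun y => ?_
  have := hδ.bracket_central S (x := 1) (y := y) (by simp [Ring.lie_def])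
  simpa [Ring.lie_def] using this

/-- Lie derivations for which `δ e` has no off-diagonal components are standard. -/
theorem isStandard_of_diagonal [CharZero K] {m : ℕ} {δ : A →ₗ[K] A}
    (hδ : IsListLieDerivation m δ) (h₁ : e * δ e * f = 0) (h₂ : f * δ e * e = 0) :
    ∃ (h : A →ₗ[K] A) (l : A →ₗ[K] K), IsDerivation h ∧ ∀ x, h x = δ x - l x • (1 : A) := by
  obtain ⟨c, hc⟩ := S.map_left_central hδ h₁ h₂
  obtain ⟨c', hc'⟩ := S.map_one_central hδ.isWeak
  have D : IsAdapted m e f δ := ⟨S, hδ.isWeak, ⟨c, hc⟩, c' - c, by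
    have := map_add δ e f
    rw [S.add_eq_one, hc, hc'] at this
    rw [sub_smul, this, add_sub_cancel_left]⟩
  have compl : ∀ a b : A, ∃ g : A →ₗ[K] A, ∀ x, g x = b * δ (a * x * a) * b := fun a b =>
    ⟨LinearMap.mulRight K b ∘ₗ LinearMap.mulLeft K b ∘ₗ δ ∘ₗ LinearMap.mulRight K a ∘ₗ
      LinearMap.mulLeft K a, fun x => by simp⟩
  obtain ⟨g₁, hg₁⟩ := compl e f
  obtain ⟨g₂, hg₂⟩ := compl f e
  obtain ⟨l₁, hl₁⟩ := exists_functional S.right_ne g₁ fun x => by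
    rw [hg₁]; exact (D.map_left_left (S.peirce_left_left x)).2.2
  obtain ⟨l₂, hl₂⟩ := exists_functional S.left_ne g₂ fun x => by
    rw [hg₂]; exact (D.symm.map_left_left (S.symm.peirce_left_left x)).2.2
  have hl₁0 : ∀ x, e * x * e = 0 → l₁ x = 0 := fun x hx => by
    have := hl₁ x
    rw [hg₁, hx, map_zero, mul_zero, zero_mul] at this
    exact (smul_eq_zero.1 this.symm).resolve_right S.right_ne
  have hl₂0 : ∀ x, f * x * f = 0 → l₂ x = 0 := fun x hx => by
    have := hl₂ x
    rw [hg₂, hx, map_zero, mul_zero, zero_mul] at this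
    exact (smul_eq_zero.1 this.symm).resolve_right S.left_ne
  -- `l₁` reads off the `f`-corner of `δ` on `eAe`, and `l₂` the `e`-corner of `δ` on `fAf`.
  let l := l₁ + l₂
  let h : A →ₗ[K] A := δ - l.smulRight (1 : A)
  have hh : ∀ x, h x = δ x - l x • (1 : A) := fun x => by simp [h]
  have hl : ∀ x, l x = l₁ x + l₂ x := fun x => rfl
  have H : PreservesPeirce e f h := by
    refine ⟨fun {x} hx => ?_, fun {x} hx => ?_, fun {x} hx => ?_, fun {x} hx => ?_⟩
    · obtain ⟨k₁, k₂, -⟩ := D.map_left_left hx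
      obtain ⟨-, -, y3, -⟩ := hx.facts S.mul_right S.mul_left
      have k₃ := hl₁ x
      rw [hg₁, hx.compress] at k₃
      refine S.peirce_of_components' ?_ ?_ ?_ <;>
        rw [hh, hl, hl₂0 x (by rw [y3, zero_mul]), add_zero, mul_sub, sub_mul]
      · simp [k₁, S.mul_left]
      · simp [k₂, S.mul_right]
      · simp [k₃, S.peirce_right.1]
    · obtain ⟨-, -, y3, y4, -⟩ := hx.facts S.mul_right S.mul_right
      rw [hh, hl, hl₁0 x (by rw [mul_assoc, y4, mul_zero]), hl₂0 x (by rw [y3, zero_mul]),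
        add_zero, zero_smul, sub_zero]
      exact D.map_left_right hδ hx
    · obtain ⟨-, -, y3, y4, -⟩ := hx.facts S.mul_left S.mul_left
      rw [hh, hl, hl₁0 x (by rw [y3, zero_mul]), hl₂0 x (by rw [mul_assoc, y4, mul_zero]),
        add_zero, zero_smul, sub_zero]
      exact D.symm.map_left_right hδ hx
    · obtain ⟨k₁, k₂, -⟩ := D.symm.map_left_left hx
      obtain ⟨-, -, y3, -⟩ := hx.facts S.mul_left S.mul_right
      have k₃ := hl₂ x
      rw [hg₂, hx.compress] at k₃
      refine S.symm.peirce_of_components' ?_ ?_ ?_ <;>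
        rw [hh, hl, hl₁0 x (by rw [y3, zero_mul]), zero_add, mul_sub, sub_mul]
      · simp [k₁, S.mul_right]
      · simp [k₂, S.mul_left]
      · simp [k₃, S.peirce_left.1]
  have central : ∀ x, (∃ c : K, δ x = c • (1 : A)) → ∃ c : K, h x = c • (1 : A) := by
    rintro x ⟨c, hc⟩
    exact ⟨c - l x, by rw [hh, hc, sub_smul]⟩
  have hw : IsWeakLieDerivation m h := by
    intro u t ht
    obtain ⟨c, t, rfl⟩ := List.exists_cons_of_length_eq_add_one ht
    refine ⟨-l (nest u (c :: t)), ?_⟩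
    rw [expansion_congr hh, hh, hδ _ _ ht, neg_smul, sub_eq_add_neg]
  have D' : IsAdapted m e f h := ⟨S, hw, central _ D.map_left, central _ D.map_right⟩
  exact ⟨h, l, D'.isDerivation H, hh⟩

/-- Every Lie `n`-derivation of an algebra with a Peirce pair is standard. -/
theorem isStandard [CharZero K] {n : ℕ} (hn : 2 ≤ n) {δ : A →ₗ[K] A}
    (hδ : IsLieNDerivation n δ) : IsStandard n δ := by
  obtain ⟨m, rfl⟩ : ∃ m, n = m + 2 := ⟨n - 2, by omega⟩
  have hδ' : IsListLieDerivation m δ := (isLieNDerivation_iff (m + 1) δ).1 hδ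
  -- With this choice `es - se` is exactly the off-diagonal part of `δ e`.
  let s := e * δ e * f - f * δ e * e
  have hs := isDerivation_innerDer (K := K) s
  obtain ⟨e1, -, e3, -, e5, -, e7, -⟩ := S.peirce_left.facts S.mul_right S.mul_left
  obtain ⟨f1, -, f3, -, f5, -, f7, -⟩ := S.peirce_right.facts S.mul_left S.mul_right
  obtain ⟨h, l, hd, hl⟩ := S.isStandard_of_diagonal (hδ'.sub (hs.isList m))
    (by
      simp only [s, LinearMap.sub_apply, innerDer_apply, mul_sub, sub_mul, mul_assoc, e1, e3, e5,
        f1, f7, mul_zero]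
      simp)
    (by
      simp only [s, LinearMap.sub_apply, innerDer_apply, mul_sub, sub_mul, mul_assoc, e1, e3, e5,
        e7, f5, f7, mul_zero]
      simp)
  have hd' : IsDerivation (h + innerDer K s) := fun x y => by
    simp only [LinearMap.add_apply, hd x y, hs x y, add_mul, mul_add]; abel
  have hl' : ∀ x, (h + innerDer K s) x = δ x - l x • (1 : A) := fun x => by
    rw [LinearMap.add_apply, hl, LinearMap.sub_apply]; abel
  refine ⟨h + innerDer K s, l.smulRight (1 : A), hd', fun x => ?_, fun x => ?_, ?_⟩
  · exact Subalgebra.smul_mem _ (one_mem _) _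
  · rw [p_succ, List.ofFn_succ]
    -- The derivation and `δ` have the same commutator expansion, so the scalar separating them on a
    -- full commutator is zero.
    have h1 := hl' (nest (x 0) (x (Fin.succ 0) :: List.ofFn fun i : Fin m => x i.succ.succ))
    rw [hd'.map_nest, hδ' _ _ (by simp), expansion_congr hl', eq_comm, sub_eq_self] at h1
    exact h1
  · ext x
    rw [LinearMap.add_apply, hl', LinearMap.smulRight_apply, sub_add_cancel]

end IsPeircePair

end algebra

/-! ### Factors: primeness, corners and projections -/

section vonNeumann

variable {H : Type*} [NormedAddCommGroup H] [InnerProductSpace ℂ H] [CompleteSpace H]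

theorem mem_iff_commute (A : VonNeumannAlgebra H) (x : H →L[ℂ] H) :
    x ∈ A ↔ ∀ g ∈ A.commutant, g * x = x * g := by
  conv_lhs => rw [← A.commutant_commutant]
  exact VonNeumannAlgebra.mem_commutant_iff

theorem cfc_mem_vonNeumann (A : VonNeumannAlgebra H) {a : H →L[ℂ] H} (ha : a ∈ A) (k : ℝ → ℝ) :
    cfc k a ∈ A := by
  rw [mem_iff_commute] at ha ⊢
  exact fun g hg => ((show Commute a g from (ha g hg).symm).cfc_real k).eq.symm

theorem starProjection_mem (A : VonNeumannAlgebra H) (V : Submodule ℂ H)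
    [V.HasOrthogonalProjection] (h : ∀ y ∈ A.commutant, ∀ v ∈ V, y v ∈ V) :
    V.starProjection ∈ A := by
  rw [VonNeumannAlgebra.IsStarProjection.mem_iff isStarProjection_starProjection]
  intro y hy
  rw [Submodule.range_starProjection, Module.End.mem_invtSubmodule_iff_forall_mem_of_mem]
  exact h y hy

/-- A factor is a prime ring. -/
theorem IsFactor.prime {A : VonNeumannAlgebra H} (hA : IsFactor A) {x y : H →L[ℂ] H} (hy : y ∈ A)
    (h : ∀ a ∈ A, x * a * y = 0) : x = 0 ∨ y = 0 := by
  -- The closed span of `A y H` is invariant under `A` and its commutant, so its projection is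
  -- central, hence scalar, and equals `1` when `y ≠ 0`. But `x` vanishes on that span.
  let s : Set H := {v | ∃ a ∈ A, ∃ w, v = a (y w)}
  let V := (Submodule.span ℂ s).topologicalClosure
  have invariant : ∀ b : H →L[ℂ] H, (∀ v ∈ s, b v ∈ s) → ∀ v ∈ V, b v ∈ V := by
    intro b hb v hv
    have h1 : Submodule.span ℂ s ≤ (Submodule.span ℂ s).comap (b : H →ₗ[ℂ] H) :=
      Submodule.span_le.2 fun v hv => Submodule.subset_span (hb v hv)
    exact map_mem_closure b.continuous hv h1
  have hP : V.starProjection ∈ A := starProjection_mem A V fun b hb => invariant b <| by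
    rintro v ⟨a, ha, w, rfl⟩
    refine ⟨a, ha, b w, ?_⟩
    have h1 := (mem_iff_commute A _).1 (mul_mem ha hy) b hb
    exact DFunLike.congr_fun h1 w
  have hP' : V.starProjection ∈ A.commutant := starProjection_mem _ V fun b hb => invariant b <| by
    rw [A.commutant_commutant] at hb
    rintro v ⟨a, ha, w, rfl⟩
    exact ⟨b * a, mul_mem hb ha, w, rfl⟩
  have hPc : V.starProjection ∈ Set.range fun c : ℂ => c • (1 : H →L[ℂ] H) := by
    rw [← hA]; exact ⟨hP, hP'⟩
  obtain ⟨c, hc⟩ := hPc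
  by_cases hy0 : y = 0
  · exact Or.inr hy0
  refine Or.inl ?_
  obtain ⟨w, hw⟩ : ∃ w, y w ≠ 0 := by
    by_contra! hn
    exact hy0 (ContinuousLinearMap.ext hn)
  have hwV : y w ∈ V :=
    Submodule.le_topologicalClosure _ (Submodule.subset_span ⟨1, one_mem A, w, rfl⟩)
  have h1 : V.starProjection (y w) = y w := Submodule.starProjection_eq_self_iff.2 hwV
  have hc1 : c = 1 := by
    rw [← hc] at h1
    have h2 : (c - 1) • y w = 0 := by
      rw [sub_smul, one_smul, sub_eq_zero]; exact h1
    exact sub_eq_zero.1 ((smul_eq_zero.1 h2).resolve_right hw)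
  have hx : ∀ v ∈ V, x v = 0 := by
    intro v hv
    have h1 : Submodule.span ℂ s ≤ LinearMap.ker (x : H →ₗ[ℂ] H) := by
      refine Submodule.span_le.2 ?_
      rintro v ⟨a, ha, w, rfl⟩
      exact DFunLike.congr_fun (h a ha) w
    have h2 : V ≤ LinearMap.ker (x : H →ₗ[ℂ] H) :=
      Submodule.topologicalClosure_minimal _ h1 x.isClosed_ker
    exact h2 hv
  ext v
  refine hx v ?_
  rw [← Submodule.starProjection_eq_self_iff, ← hc, hc1]
  simp

/-- If the spectrum of `a` is contained in `{r, s}`, then `(a - r) * (a - s) = 0`. -/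
theorem mul_sub_eq_zero_of_spectrum {a : H →L[ℂ] H} (ha : IsSelfAdjoint a) {r s : ℝ}
    (h : ∀ x ∈ spectrum ℝ a, x = r ∨ x = s) :
    (a - r • (1 : H →L[ℂ] H)) * (a - s • (1 : H →L[ℂ] H)) = 0 := by
  have h1 : ∀ r : ℝ, cfc (fun x : ℝ => x - r) a = a - r • (1 : H →L[ℂ] H) := fun r => by
    rw [cfc_sub (fun x => x) (fun _ => r) a, cfc_id' ℝ a, cfc_const r a, Algebra.algebraMap_eq_smul_one]
  rw [← h1, ← h1, ← cfc_mul (fun x : ℝ => x - r) (fun x => x - s) a, ← cfc_zero ℝ a]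
  refine cfc_congr fun x hx => ?_
  rcases h x hx with rfl | rfl <;> simp

/-- Two distinct points of the spectrum can be separated by functions with product zero. -/
theorem exists_separation {a : H →L[ℂ] H} (ha : IsSelfAdjoint a) {s t : ℝ}
    (hs : s ∈ spectrum ℝ a) (ht : t ∈ spectrum ℝ a) (hst : s < t) :
    ∃ k l : ℝ → ℝ, cfc k a * cfc l a = 0 ∧ (s ≠ 0 → a * cfc l a ≠ 0) ∧
      (t ≠ 0 → a * cfc k a ≠ 0) ∧ cfc k a ≠ 0 ∧ cfc l a ≠ 0 := by
  set c := (s + t) / 2 with hc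
  have ne : ∀ k : ℝ → ℝ, Continuous k → ∀ r ∈ spectrum ℝ a, k r ≠ 0 → cfc k a ≠ 0 := by
    intro k hk r hr hkr h0
    rw [← cfc_zero ℝ a] at h0
    exact hkr (eqOn_of_cfc_eq_cfc h0 hk.continuousOn (by fun_prop) ha hr)
  have hk : Continuous fun x : ℝ => max (x - c) 0 := by fun_prop
  have hl : Continuous fun x : ℝ => max (c - x) 0 := by fun_prop
  have hkt : max (t - c) 0 ≠ 0 := (lt_max_of_lt_left (by linarith)).ne'
  have hls : max (c - s) 0 ≠ 0 := (lt_max_of_lt_left (by linarith)).ne'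
  have mul : ∀ k : ℝ → ℝ, Continuous k → a * cfc k a = cfc (fun x => x * k x) a := fun k hk => by
    rw [cfc_mul (fun x => x) k a (by fun_prop) hk.continuousOn, cfc_id' ℝ a]
  refine ⟨fun x => max (x - c) 0, fun x => max (c - x) 0, ?_, fun h => ?_, fun h => ?_,
    ne _ hk t ht hkt, ne _ hl s hs hls⟩
  · rw [← cfc_mul _ _ a hk.continuousOn hl.continuousOn, ← cfc_zero ℝ a]
    refine cfc_congr fun x _ => ?_
    rcases le_total x c with h | h
    · simp [max_eq_right (sub_nonpos.2 h)]
    · simp [max_eq_right (sub_nonpos.2 h)]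
  · rw [mul _ hl]
    exact ne _ (by fun_prop) s hs (mul_ne_zero h hls)
  · rw [mul _ hk]
    exact ne _ (by fun_prop) t ht (mul_ne_zero h hkt)

/-- Primeness forbids zero divisors among functions of `z` in the corner. Thus the spectrum has at
most one nonzero point `r`, and `z(z - re) = 0` forces one factor to vanish. -/
theorem IsFactor.corner_selfAdjoint {A : VonNeumannAlgebra H} (hA : IsFactor A)
    {e z : H →L[ℂ] H} (he : e ∈ A) (hz : z ∈ A) (hee : e * e = e) (hez : e * z = z) (hze : z * e = z)
    (hsa : IsSelfAdjoint z) (hc : ∀ a ∈ A, z * (e * a * e) = e * a * e * z) :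
    ∃ c : ℂ, z = c • e := by
  have key : ∀ x y, y ∈ A → x * e = x → e * y = y → (∀ w, Commute z w → Commute x w) →
      x * y = 0 → x = 0 ∨ y = 0 := by
    intro x y hy hx hy' hcomm hxy
    refine hA.prime hy fun a ha => ?_
    have h1 : x * (e * a * e) = e * a * e * x := hcomm _ (hc a ha)
    calc x * a * y = x * e * a * (e * y) := by rw [hx, hy']
      _ = x * (e * a * e) * y := by simp only [mul_assoc]
      _ = 0 := by rw [h1, mul_assoc, hxy, mul_zero]
  have cz : ∀ k : ℝ → ℝ, Commute z (cfc k z) := fun k => ((Commute.refl z).cfc_real k).symm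
  have two : ∀ s ∈ spectrum ℝ z, ∀ t ∈ spectrum ℝ z, s ≠ 0 → t ≠ 0 → ¬ s < t := by
    intro s hs t ht hs0 ht0 hst
    obtain ⟨k, l, hkl, h1, h2, -⟩ := exists_separation hsa hs ht hst
    -- The extra factor `z` places both functions of `z` in the corner; they are nonzero because `s`
    -- and `t` are.
    refine (key (z * cfc k z) (z * cfc l z) (mul_mem hz (cfc_mem_vonNeumann A hz l)) ?_ ?_ ?_
      ?_).elim (h2 ht0) (h1 hs0)
    · rw [(cz k).eq, mul_assoc, hze]
    · rw [← mul_assoc, hez]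
    · exact fun w hw => hw.mul_left (hw.cfc_real k)
    · rw [(cz k).eq, mul_assoc, ← mul_assoc z z, ← ((cz l).mul_left (cz l)).eq.symm,
        ← mul_assoc, hkl, zero_mul]
  obtain ⟨r, hr⟩ : ∃ r : ℝ, ∀ x ∈ spectrum ℝ z, x = 0 ∨ x = r := by
    by_cases h : ∃ r ∈ spectrum ℝ z, r ≠ 0
    · obtain ⟨r, hr, hr0⟩ := h
      refine ⟨r, fun x hx => or_iff_not_imp_left.2 fun hx0 => ?_⟩
      exact le_antisymm (not_lt.1 (two r hr x hx hr0 hx0)) (not_lt.1 (two x hx r hr hx0 hr0))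
    · push Not at h
      exact ⟨0, fun x hx => Or.inl (h x hx)⟩
  have h0 := mul_sub_eq_zero_of_spectrum hsa hr
  rw [zero_smul, sub_zero, mul_sub, mul_smul_comm, mul_one] at h0
  have hy : z - (r : ℂ) • e ∈ A :=
    sub_mem hz (A.toStarSubalgebra.smul_mem he _)
  rcases key z (z - (r : ℂ) • e) hy hze (by rw [mul_sub, hez, mul_smul_comm, hee])
    (fun w hw => hw) (by rw [mul_sub, mul_smul_comm, hze, Complex.coe_smul, h0]) with h | h
  · exact ⟨0, by rw [h, zero_smul]⟩
  · exact ⟨r, sub_eq_zero.1 h⟩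

theorem IsFactor.corner {A : VonNeumannAlgebra H} (hA : IsFactor A)
    {e z : H →L[ℂ] H} (he : e ∈ A) (hep : IsStarProjection e) (hz : z ∈ A) (hez : e * z = z)
    (hze : z * e = z) (hc : ∀ a ∈ A, z * (e * a * e) = e * a * e * z) :
    ∃ c : ℂ, z = c • e := by
  have hee : e * e = e := hep.isIdempotentElem
  have hes : star e = e := hep.isSelfAdjoint
  have hez' : e * star z = star z := by simpa [hes] using congrArg star hze
  have hze' : star z * e = star z := by simpa [hes] using congrArg star hez
  have hc' : ∀ a ∈ A, star z * (e * a * e) = e * a * e * star z := fun a ha => by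
    simpa [hes, mul_assoc] using (congrArg star (hc (star a) (star_mem ha))).symm
  have hz' : star z ∈ A := star_mem hz
  have hI : ∀ {w}, w ∈ A → Complex.I • w ∈ A := fun hw => A.toStarSubalgebra.smul_mem hw _
  obtain ⟨c, hc1⟩ := hA.corner_selfAdjoint he (add_mem hz hz') hee (by rw [mul_add, hez, hez'])
    (by rw [add_mul, hze, hze']) (IsSelfAdjoint.add_star_self z)
    (fun a ha => by rw [add_mul, mul_add, hc a ha, hc' a ha])
  obtain ⟨d, hd1⟩ := hA.corner_selfAdjoint he (hI (sub_mem hz hz')) hee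
    (by rw [mul_smul_comm, mul_sub, hez, hez']) (by rw [smul_mul_assoc, sub_mul, hze, hze'])
    (by
      rw [isSelfAdjoint_iff, star_smul, star_sub, star_star, Complex.star_def, Complex.conj_I,
        neg_smul, ← smul_neg, neg_sub])
    (fun a ha => by rw [smul_mul_assoc, mul_smul_comm, sub_mul, mul_sub, hc a ha, hc' a ha])
  -- Here `c` and `d` are the coefficients of `z + star z` and `I • (z - star z)`.
  refine ⟨(c - Complex.I * d) / 2, ?_⟩
  have h1 : z - star z = -(Complex.I • d • e) := by
    rw [← hd1, smul_smul, Complex.I_mul_I, neg_smul, one_smul, neg_neg]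
  have h2 : (2 : ℂ) • z = (c - Complex.I * d) • e := by
    rw [two_smul, sub_smul, mul_smul, sub_eq_add_neg, ← h1, ← hc1]; abel
  rw [div_eq_inv_mul, mul_smul, ← h2, inv_smul_smul₀ two_ne_zero]

/-- A nonscalar self-adjoint element of a von Neumann algebra yields a nontrivial projection. -/
theorem exists_projection_of_selfAdjoint (A : VonNeumannAlgebra H) {a : H →L[ℂ] H} (ha : a ∈ A)
    (hsa : IsSelfAdjoint a) (h : ∀ c : ℂ, a ≠ c • (1 : H →L[ℂ] H)) :
    ∃ e ∈ A, IsStarProjection e ∧ e ≠ 0 ∧ e ≠ 1 := by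
  obtain ⟨s, hs, t, ht, hst⟩ : ∃ s ∈ spectrum ℝ a, ∃ t ∈ spectrum ℝ a, s < t := by
    by_contra! hn
    have hsub : ∃ r : ℝ, ∀ x ∈ spectrum ℝ a, x = r := by
      by_cases hne : (spectrum ℝ a).Nonempty
      · obtain ⟨r, hr⟩ := hne
        exact ⟨r, fun x hx => le_antisymm (hn r hr x hx) (hn x hx r hr)⟩
      · exact ⟨0, fun x hx => (hne ⟨x, hx⟩).elim⟩
    obtain ⟨r, hr⟩ := hsub
    refine h r ?_
    rw [← cfc_id' ℝ a, cfc_congr (f := fun x : ℝ => x) (g := fun _ => r) hr, cfc_const r a,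
      Algebra.algebraMap_eq_smul_one, Complex.coe_smul]
  obtain ⟨k, l, hkl, -, -, hk, hl⟩ := exists_separation hsa hs ht hst
  have hkA := cfc_mem_vonNeumann A ha k
  -- This kernel contains the range of the nonzero operator `cfc l a`, and is proper because `cfc k
  -- a ≠ 0`.
  let V : Submodule ℂ H := LinearMap.ker (cfc k a).toLinearMap
  have hV : IsClosed (V : Set H) := (cfc k a).isClosed_ker
  have : CompleteSpace V := hV.completeSpace_coe
  refine ⟨V.starProjection, starProjection_mem A V fun y hy v hv => ?_,
    isStarProjection_starProjection, fun h0 => hl ?_, fun h1 => hk ?_⟩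
  · have h1 := DFunLike.congr_fun ((mem_iff_commute A _).1 hkA y hy) v
    have h2 : cfc k a v = 0 := hv
    change cfc k a (y v) = 0
    change y (cfc k a v) = cfc k a (y v) at h1
    rw [← h1, h2, map_zero]
  · ext v
    have hv : cfc l a v ∈ V := DFunLike.congr_fun hkl v
    rw [← Submodule.starProjection_eq_self_iff, h0] at hv
    exact hv.symm
  · ext v
    have hv : v ∈ V := by rw [← Submodule.starProjection_eq_self_iff, h1]; rfl
    exact hv

theorem exists_projection (A : VonNeumannAlgebra H)
    (hdim : 2 ≤ Module.rank ℂ A.toStarSubalgebra) :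
    ∃ e ∈ A, IsStarProjection e ∧ e ≠ 0 ∧ e ≠ 1 := by
  by_contra hn
  have hsc : ∀ a ∈ A, IsSelfAdjoint a → ∃ c : ℂ, a = c • (1 : H →L[ℂ] H) := by
    intro a ha hsa
    by_contra! h
    exact hn (exists_projection_of_selfAdjoint A ha hsa h)
  have hall : ∀ a ∈ A, ∃ c : ℂ, a = c • (1 : H →L[ℂ] H) := by
    intro a ha
    have h1 : (1 / 2 : ℂ) • (a + star a) ∈ A :=
      A.toStarSubalgebra.smul_mem (add_mem ha (star_mem ha)) _
    have h2 : (Complex.I / 2 : ℂ) • (a - star a) ∈ A :=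
      A.toStarSubalgebra.smul_mem (sub_mem ha (star_mem ha)) _
    obtain ⟨c, hc⟩ := hsc _ h1 (by simp [isSelfAdjoint_iff, add_comm])
    obtain ⟨d, hd⟩ := hsc _ h2 (by
      simp only [isSelfAdjoint_iff, star_smul, star_sub, star_star, Complex.star_def, map_div₀,
        Complex.conj_I, Complex.conj_ofNat, neg_div, neg_smul]
      rw [← smul_neg, neg_sub])
    refine ⟨c - Complex.I * d, ?_⟩
    rw [sub_smul, mul_smul, ← hc, ← hd, smul_smul, ← mul_div_assoc, Complex.I_mul_I]
    module
  have : Module.rank ℂ A.toStarSubalgebra ≤ 1 := by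
    rw [rank_le_one_iff]
    refine ⟨1, fun v => ?_⟩
    obtain ⟨c, hc⟩ := hall v v.2
    exact ⟨c, Subtype.ext hc.symm⟩
  exact absurd (hdim.trans this) (by norm_num)

theorem IsFactor.isPeircePair {A : VonNeumannAlgebra H} (hA : IsFactor A)
    {e : H →L[ℂ] H} (he : e ∈ A) (hep : IsStarProjection e) (h0 : e ≠ 0) (h1 : e ≠ 1) :
    IsPeircePair ℂ (⟨e, he⟩ : A.toStarSubalgebra) (1 - ⟨e, he⟩) := by
  have hee : (⟨e, he⟩ : A.toStarSubalgebra) * ⟨e, he⟩ = ⟨e, he⟩ :=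
    Subtype.ext hep.isIdempotentElem
  have corner : ∀ p : A.toStarSubalgebra, IsStarProjection (p : H →L[ℂ] H) →
      ∀ z, Peirce p p z → (∀ a, Peirce p p a → z * a = a * z) → ∃ c : ℂ, z = c • p := by
    intro p hp z hz hcomm
    have hpp : p * p = p := Subtype.ext hp.isIdempotentElem
    obtain ⟨c, hc⟩ := hA.corner p.2 hp z.2 (congrArg Subtype.val hz.1)
      (congrArg Subtype.val hz.2) fun a ha => congrArg Subtype.val <|
        hcomm (p * ⟨a, ha⟩ * p) ⟨by rw [← mul_assoc, ← mul_assoc, hpp], by rw [mul_assoc, hpp]⟩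
    exact ⟨c, Subtype.ext hc⟩
  refine ⟨add_sub_cancel _ _, by rw [mul_sub, mul_one, hee, sub_self],
    by rw [sub_mul, one_mul, hee, sub_self], fun h => h0 (congrArg Subtype.val h),
    fun h => h1 (congrArg Subtype.val (sub_eq_zero.1 h)).symm, fun x y h => ?_, corner _ hep,
    corner _ hep.one_sub⟩
  exact (hA.prime y.2 fun a ha => congrArg Subtype.val (h ⟨a, ha⟩)).imp Subtype.ext Subtype.ext

end vonNeumann
end LieN

theorem mainTheorem11 {H : Type*} [NormedAddCommGroup H] [InnerProductSpace ℂ H] [CompleteSpace H]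
    (A : VonNeumannAlgebra H) (hA : LieN.IsFactor A)
    (hdim : 2 ≤ Module.rank ℂ A.toStarSubalgebra)
    (n : ℕ) (hn : 2 ≤ n)
    (δ : A.toStarSubalgebra →ₗ[ℂ] A.toStarSubalgebra) (hδ : LieN.IsLieNDerivation n δ) :
    LieN.IsStandard n δ := by
  obtain ⟨e, he, hep, h0, h1⟩ := LieN.exists_projection A hdim
  exact (hA.isPeircePair he hep h0 h1).isStandard hn hδ
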